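/- All spaces $\mathbb{R}^s$ and their products carry the Euclidean norm. For $A\subset\mathbb{R}^s$ let $T_A(\bar x)=\{u : \exists\, t_k\searrow 0,\ u_k\to u,\ \bar x+t_ku_k\in A\ \forall k\}$ be the tangent cone; $\widehat N_A(x)=\{\xi : \langle \xi,u\rangle\le 0\ \forall u\in T_A(x)\}$ for $x\in A$ and $\widehat N_A(x)=\emptyset$ for $x\notin A$ the regular normal cone; and $N_A(\bar x;u)=\{\xi : \exists\, t_k\searrow0,\ u_k\to u,\ \xi_k\to\xi,\ \xi_k\in\widehat N_A(\bar x+t_ku_k)\ \forall k\}$ the directional limiting normal cone. A tangent $u\in T_A(\bar x)$ is *derivable* if there are $\varepsilon>0$ and $\xi:[0,\varepsilon]\to A$ with $\xi(0)=\bar x$ and $\xi(t)-(\bar x+tu)=o(t)$ as $t\searrow 0$. For a multifunction $F$ with graph $\operatorname{gph}F=\{(x,y): y\in F(x)\}$ and $(\bar x,\bar y)\in\operatorname{gph}F$ put $$DF(\bar x,\bar y)(u)=\{v : (u,v)\in T_{\operatorname{gph}F}(\bar x,\bar y)\},\qquad D^*F((\bar x,\bar y);(u,v))(y^*)=\{x^*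 : (x^*,-y^*)\in N_{\operatorname{gph}F}((\bar x,\bar y);(u,v))\}.$$ $F$ is *calm* at a point $(\bar y,\bar x)$ with $\bar x\in F(\bar y)$ if there are $\kappa\ge0$, $\varepsilon>0$ such that $\operatorname{dist}(x,F(\bar y))\le\kappa\|y-\bar y\|$ whenever $\|y-\bar y\|<\varepsilon$, $\|x-\bar x\|<\varepsilon$ and $x\in F(y)$. Let $M:\mathbb{R}^l\times\mathbb{R}^n\rightrightarrows\mathbb{R}^m$ be a multifunction with closed graph, let $S(p)=\{x : 0\in M(p,x)\}$, and let $\bar x\in S(\bar p)$. Write $M_{\bar p}(x)=M(\bar p,x)$, $H_M(p)=\{(x,y): y\in M(p,x)\}$ and $\operatorname{dom}H_M=\{p: H_M(p)\ne\emptyset\}$. The *outer coderivative of $M$ with respect to $p$ in direction $u$*, $D^*_{>_p}M((\bar p,\bar x,0);u)(v^*)$, is the set of all $(q^*,u^*)$ for which there are sequences $t_k\searrow0$, $(q_k,u_k,v_k)\to(0,u,0)$, $(q_k^*,u_k^*,v_k^*)\to(q^*,u^*,v^*)$ with $q_k\ne0$ and $(q_k^*,u_k^*,-v_k^*)\in\widehat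 N_{\operatorname{gph}M}(\bar p+t_kq_k,\bar x+t_ku_k,t_kv_k)$ for all $k$. **(i)** Assume that there are no $u\neq0$, $q\in T_{\operatorname{dom}H_M}(\bar p)$ and $q^*$ with $\|q^*\|=1$ such that $$0\in DM(\bar p,\bar x,0)(0,u),\qquad (q^*,0)\in D^*_{>_p}M((\bar p,\bar x,0);u)(0),\qquad \langle q^*,q\rangle=-1,$$ and that there are also no $\hat u\ne0$ and $v^*$ with $\|v^*\|=1$ such that $$0\in DM_{\bar p}(\bar x,0)(\hat u),\qquad 0\in D^*M_{\bar p}((\bar x,0);(\hat u,0))(v^*).$$ Then $S$ is calm at $(\bar p,\bar x)$. **(ii)** Assume that there are no $u\ne0$ and $(q^*,v^*)\ne(0,0)$ such that $$0\in DM(\bar p,\bar x,0)(0,u),\qquad (q^*,0)\in D^*M((\bar p,\bar x,0);(0,u,0))(v^*),$$ and that there exists $\tilde u\neq0$ such that $(0,\tilde u,0)\in T_{\operatorname{gph}M}(\bar p,\bar x,0)$ and $(0,\tilde u,0)$ is derivable. Then $S$ is calm at $(\bar p,\bar x)$, and there exist a real $\tilde L$ and a neighborhood $\tilde W$ of $\bar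 p$ such that $$S(p)\ne\emptyset,\qquad \operatorname{dist}(\bar x,S(p))\le\tilde L\|p-\bar p\|\qquad\forall p\in\tilde W.$$ -/

import Mathlib

open Filter Topology Asymptotics

noncomputable section

namespace ImplicitMultifunction

section Cones

variable {E : Type*} [NormedAddCommGroup E] [InnerProductSpace ℝ E]

/-- The tangent (contingent) cone to `A` at `x`: the outer limit of the sets `(A - x) / t`
as `t` decreases to `0`. -/
def tangentCone (A : Set E) (x : E) : Set E :=
  {u | ∃ (t : ℕ → ℝ) (w : ℕ → E), (∀ k, 0 < t k) ∧ Tendsto t atTop (𝓝 0) ∧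
    Tendsto w atTop (𝓝 u) ∧ ∀ k, x + t k • w k ∈ A}

/-- The regular normal cone to `A` at `x`: the (negative) polar of the tangent cone if `x ∈ A`,
and the empty set if `x ∉ A`. -/
def regularNormalCone (A : Set E) (x : E) : Set E :=
  {ξ | x ∈ A ∧ ∀ u ∈ tangentCone A x, inner ℝ ξ u ≤ 0}

/-- The directional limiting normal cone to `A` at `x` in direction `u`: the outer limit of the
regular normal cones at `x + t • u'` as `t` decreases to `0` and `u'` tends to `u`. -/
def directionalNormalCone (A : Set E) (x u : E) : Set E :=
  {ξ | ∃ (t : ℕ → ℝ) (w η : ℕ → E), (∀ k, 0 < t k) ∧ Tendsto t atTop (𝓝 0) ∧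
    Tendsto w atTop (𝓝 u) ∧ Tendsto η atTop (𝓝 ξ) ∧
    ∀ k, η k ∈ regularNormalCone A (x + t k • w k)}

/-- `u` is a derivable tangent to `A` at `x`. -/
def IsDerivableTangent (A : Set E) (x u : E) : Prop :=
  u ∈ tangentCone A x ∧ ∃ ε > 0, ∃ ξ : ℝ → E, (∀ t ∈ Set.Icc 0 ε, ξ t ∈ A) ∧ ξ 0 = x ∧
    (fun t : ℝ => ξ t - (x + t • u)) =o[𝓝[>] 0] (fun t : ℝ => t)

/-- Comparison with the tangent cone of Mathlib over the scalars `ℝ≥0`. -/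
theorem tangentCone_eq_tangentConeAt (A : Set E) (x : E) :
    tangentCone A x = tangentConeAt NNReal A x := by
  ext u
  rw [mem_tangentConeAt_iff_exists_seq]
  constructor
  · rintro ⟨t, w, ht, ht0, hw, hA⟩
    refine ⟨fun k => Real.toNNReal (t k)⁻¹, fun k => t k • w k, ?_,
      Eventually.of_forall hA, ?_⟩
    · simpa using ht0.smul hw
    · refine hw.congr fun k => ?_
      beta_reduce
      rw [NNReal.smul_def, Real.coe_toNNReal _ (inv_pos.2 (ht k)).le, smul_smul, inv_mul_cancel₀ (ht k).ne', one_smul]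
  · rintro ⟨c, d, hd, hA, hcd⟩
    obtain ⟨N, hN⟩ := eventually_atTop.1 hA
    by_cases hu : u = 0
    · subst hu
      have hs : Tendsto (fun k => Real.sqrt ‖d k‖) atTop (𝓝 0) := by
        have h5 := (Real.continuous_sqrt.tendsto 0).comp (tendsto_zero_iff_norm_tendsto_zero.1 hd)
        rw [Real.sqrt_zero] at h5
        exact h5
      have h1 : Tendsto (fun k : ℕ => 1 / ((k : ℝ) + 1)) atTop (𝓝 0) :=
        tendsto_one_div_add_atTop_nhds_zero_nat
      have hpos : ∀ k : ℕ, 0 < Real.sqrt ‖d k‖ + 1 / ((k : ℝ) + 1) := fun k => by positivity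
      refine ⟨fun k => Real.sqrt ‖d (k + N)‖ + 1 / (((k + N : ℕ) : ℝ) + 1),
        fun k => (Real.sqrt ‖d (k + N)‖ + 1 / (((k + N : ℕ) : ℝ) + 1))⁻¹ • d (k + N),
        fun k => hpos _, ?_, ?_, fun k => ?_⟩
      · simpa using (tendsto_add_atTop_iff_nat N).2 (hs.add h1)
      · refine squeeze_zero_norm (fun k => ?_) ((tendsto_add_atTop_iff_nat N).2 hs)
        rw [norm_smul, norm_inv, Real.norm_of_nonneg (hpos _).le, inv_mul_le_iff₀ (hpos _)]
        have h2 := Real.mul_self_sqrt (norm_nonneg (d (k + N)))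
        have h3 : 0 ≤ 1 / (((k + N : ℕ) : ℝ) + 1) * Real.sqrt ‖d (k + N)‖ := by positivity
        nlinarith
      · beta_reduce
        rw [smul_smul, mul_inv_cancel₀ (hpos _).ne', one_smul]
        exact hN _ (Nat.le_add_left _ _)
    · have hne : ∀ᶠ k in atTop, c k • d k ≠ 0 := hcd.eventually_ne hu
      obtain ⟨N', hN'⟩ := eventually_atTop.1 hne
      have hc : ∀ k, N' ≤ k → 0 < (c k : ℝ) := fun k hk => by
        rcases eq_or_ne (c k) 0 with h | h
        · exact absurd (by rw [h, zero_smul]) (hN' k hk)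
        · exact NNReal.coe_pos.2 (pos_iff_ne_zero.2 h)
      have hinv : Tendsto (fun k => ((c k : ℝ))⁻¹) atTop (𝓝 0) := by
        have h4 : Tendsto (fun k => ‖d k‖ / ‖c k • d k‖) atTop (𝓝 0) := by
          have h5 := (tendsto_zero_iff_norm_tendsto_zero.1 hd).div hcd.norm (norm_ne_zero_iff.2 hu)
          rw [zero_div] at h5
          exact h5
        refine h4.congr' ?_
        filter_upwards [eventually_ge_atTop N'] with k hk
        have hdk : ‖d k‖ ≠ 0 := fun h => hN' k hk (by rw [norm_eq_zero.1 h, smul_zero])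
        have := hc k hk
        rw [NNReal.smul_def, norm_smul, Real.norm_of_nonneg this.le]
        field_simp
      refine ⟨fun k => ((c (k + (N + N')) : ℝ))⁻¹, fun k => c (k + (N + N')) • d (k + (N + N')),
        fun k => inv_pos.2 (hc _ (by omega)), (tendsto_add_atTop_iff_nat (N + N')).2 hinv,
        (tendsto_add_atTop_iff_nat (N + N')).2 hcd, fun k => ?_⟩
      have := hc (k + (N + N')) (by omega)
      beta_reduce
      rw [NNReal.smul_def, smul_smul, inv_mul_cancel₀ this.ne', one_smul]
      exact hN _ (by omega)

end Cones

section Multifunctions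

/-- The pair `(a, b)` as a point of the product with its Euclidean structure. -/
abbrev pair {E F : Type*} (a : E) (b : F) : WithLp 2 (E × F) := WithLp.toLp 2 (a, b)

/-- The graph of a multifunction. -/
def graph {E F : Type*} (Φ : E → Set F) : Set (WithLp 2 (E × F)) :=
  {z | z.snd ∈ Φ z.fst}

/-- The domain of a multifunction. -/
def domain {E F : Type*} (Φ : E → Set F) : Set E :=
  {x | (Φ x).Nonempty}

/-- Calmness of the multifunction `Φ` at a point `(y₀, x₀)` of its graph. -/
def IsCalmAt {Y X : Type*} [MetricSpace Y] [MetricSpace X] (Φ : Y → Set X) (y₀ : Y) (x₀ : X) :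
    Prop :=
  x₀ ∈ Φ y₀ ∧ ∃ κ : ℝ, 0 ≤ κ ∧ ∃ ε > 0, ∀ (y : Y) (x : X), dist y y₀ < ε → dist x x₀ < ε →
    x ∈ Φ y → Metric.infDist x (Φ y₀) ≤ κ * dist y y₀

variable {E F : Type*} [NormedAddCommGroup E] [InnerProductSpace ℝ E]
  [NormedAddCommGroup F] [InnerProductSpace ℝ F]

/-- The graphical derivative `DΦ(x, y)`. -/
def graphicalDerivative (Φ : E → Set F) (x : E) (y : F) (u : E) : Set F :=
  {v | pair u v ∈ tangentCone (graph Φ) (pair x y)}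

/-- The directional limiting coderivative `D*Φ((x, y); (u, v))`. -/
def directionalCoderivative (Φ : E → Set F) (x : E) (y : F) (u : E) (v : F) (yStar : F) :
    Set E :=
  {xStar | pair xStar (-yStar) ∈ directionalNormalCone (graph Φ) (pair x y) (pair u v)}

end Multifunctions

section Implicit

variable {P X Y : Type*} [NormedAddCommGroup P] [InnerProductSpace ℝ P]
  [NormedAddCommGroup X] [InnerProductSpace ℝ X] [NormedAddCommGroup Y] [InnerProductSpace ℝ Y]

/-- The solution map `S(p) = {x | 0 ∈ M(p, x)}`. -/
def solutionMap (M : WithLp 2 (P × X) → Set Y) (p : P) : Set X :=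
  {x | 0 ∈ M (pair p x)}

/-- The partial multifunction `M_p(x) = M(p, x)`. -/
def partialMap (M : WithLp 2 (P × X) → Set Y) (p : P) (x : X) : Set Y :=
  M (pair p x)

/-- The multifunction `H_M(p) = {(x, y) | y ∈ M(p, x)}`. -/
def paramGraph (M : WithLp 2 (P × X) → Set Y) (p : P) : Set (WithLp 2 (X × Y)) :=
  {z | z.snd ∈ M (pair p z.fst)}

/-- The outer coderivative `D*_{>p} M((p₀, x₀, 0); u)` of `M` with respect to `p` in direction `u`
at the point `(p₀, x₀, 0)`. -/
def outerCoderivative (M : WithLp 2 (P × X) → Set Y) (p₀ : P) (x₀ : X) (u : X) (vStar : Y) :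
    Set (WithLp 2 (P × X)) :=
  {ζ | ∃ (t : ℕ → ℝ) (q : ℕ → P) (w : ℕ → X) (v : ℕ → Y)
      (qs : ℕ → P) (us : ℕ → X) (vs : ℕ → Y),
    (∀ k, 0 < t k) ∧ Tendsto t atTop (𝓝 0) ∧
    Tendsto q atTop (𝓝 0) ∧ Tendsto w atTop (𝓝 u) ∧ Tendsto v atTop (𝓝 0) ∧
    Tendsto qs atTop (𝓝 ζ.fst) ∧ Tendsto us atTop (𝓝 ζ.snd) ∧ Tendsto vs atTop (𝓝 vStar) ∧
    ∀ k, q k ≠ 0 ∧ pair (pair (qs k) (us k)) (-vs k) ∈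
      regularNormalCone (graph M) (pair (pair (p₀ + t k • q k) (x₀ + t k • w k)) (t k • v k))}

end Implicit

end ImplicitMultifunction

end

open ImplicitMultifunction

/-! Everything reduces to one variational argument for a linear map `G` on a closed set `A`. If `G
z₀` is close to a value `g` that `G` does not attain on `A` within distance `d` of `z₀`, minimizing
`‖G z - g‖ + d⁻¹ * ‖z - z₀‖ ^ 2` over `A` gives a nearby point with a regular normal close to `-G*
a`, `‖a‖ = 1` (`exists_regularNormal_of_ne`). If the residual is `o(d)` along a sequence, the
displacement is also `o(d)`, so the direction of approach survives and `-G* a` is a directional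
limiting normal. Forbidding such normals yields, by contradiction, an error bound for `G` on `A`
(`exists_infDist_le_of_directionalNormalCone`) and, along a derivable tangent, solvability with
linear rate (`exists_linear_bound_preimage_of_isDerivableTangent`).

For (ii), take `A = gph M` and `G (p, x, y) = (p, y)`: the error bound at the points `(p, x, 0)` is
calmness of `S`, and solvability at the values `(p, 0)` is the remaining claim.

For (i), the condition on `M_{p₀}` first gives a subregularity constant `κ`. If calmness fails along
`(p_k, x_k)`, then `gph M` has no point with parameter `p₀` within `dist(x_k, S(p₀)) / (1 + κ)` of
`(p_k, x_k, 0)`. The variational argument with `G (p, x, y) = p` then produces the excluded outer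
coderivative element. -/

namespace ImplicitMultifunction

/-! ### Variational principle and regularity of a linear map on a closed set -/

section VariationalPrinciple

variable {E F : Type*} [NormedAddCommGroup E] [InnerProductSpace ℝ E]
  [NormedAddCommGroup F] [InnerProductSpace ℝ F]

/-- Fermat's rule: minus the gradient at a local minimizer is a regular normal. -/
theorem neg_mem_regularNormalCone_of_isLocalMinOn {A : Set E} {z g : E} {φ : E → ℝ}
    (hz : z ∈ A) (hmin : IsLocalMinOn φ A z) (hφ : HasFDerivAt φ (innerSL ℝ g) z) :
    -g ∈ regularNormalCone A z := by
  refine ⟨hz, fun w hw => ?_⟩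
  rw [tangentCone_eq_tangentConeAt] at hw
  have h := hmin.hasFDerivWithinAt_nonneg hφ.hasFDerivWithinAt hw
  rw [innerSL_apply_apply] at h
  rw [inner_neg_left]
  linarith

theorem hasFDerivAt_norm_sub [CompleteSpace E] [CompleteSpace F] (G : E →L[ℝ] F) (g : F) {z : E}
    (h : G z - g ≠ 0) :
    HasFDerivAt (fun y => ‖G y - g‖)
      (innerSL ℝ (ContinuousLinearMap.adjoint G (‖G z - g‖⁻¹ • (G z - g)))) z := by
  have h1 : HasFDerivAt (fun y => G y - g) G z := G.hasFDerivAt.sub_const g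
  have h2 := h1.norm_sq.sqrt (by positivity)
  simp only [Real.sqrt_sq (norm_nonneg _)] at h2
  refine h2.congr_fderiv ?_
  ext w
  simp only [smul_apply, ContinuousLinearMap.comp_apply, innerSL_apply_apply,
    ContinuousLinearMap.adjoint_inner_left, inner_smul_left, smul_eq_mul, nsmul_eq_mul]
  have : ‖G z - g‖ ≠ 0 := norm_ne_zero_iff.2 h
  simp
  field_simp

/-- A closed set on which the distance of `G` to `g` is small at `z₀` but does not vanish near `z₀`
has a regular normal near `z₀` that almost is a unit vector in the range of the adjoint of `G`. -/
theorem exists_regularNormal_of_ne [FiniteDimensional ℝ E] [CompleteSpace E] [CompleteSpace F]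
    {A : Set E} (hA : IsClosed A) (G : E →L[ℝ] F) {g : F} {z₀ : E} (hz₀ : z₀ ∈ A) {d : ℝ}
    (hd : ‖G z₀ - g‖ < d) (hne : ∀ z ∈ A, ‖z - z₀‖ < d → G z ≠ g) :
    ∃ z ∈ A, ‖z - z₀‖ ^ 2 ≤ ‖G z₀ - g‖ * d ∧ ‖G z - g‖ ≤ ‖G z₀ - g‖ ∧ G z ≠ g ∧
      ∃ ξ ∈ regularNormalCone A z,
        ‖ξ + ContinuousLinearMap.adjoint G (‖G z - g‖⁻¹ • (G z - g))‖ ≤ 2 / d * ‖z - z₀‖ := by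
  have hd0 : 0 < d := (norm_nonneg _).trans_lt hd
  -- The weight `d⁻¹` makes the penalty equal to `d` on the sphere of radius `d`, above `φ z₀ < d`.
  -- A minimizer over the closed ball is therefore interior, where `G z ≠ g` and `φ` is
  -- differentiable.
  set φ : E → ℝ := fun z => ‖G z - g‖ + d⁻¹ * ‖z - z₀‖ ^ 2 with hφ
  have hc : Continuous φ := by fun_prop
  have hφ0 : φ z₀ = ‖G z₀ - g‖ := by simp [hφ]
  have hK : IsCompact (A ∩ Metric.closedBall z₀ d) := (isCompact_closedBall z₀ d).inter_left hA
  obtain ⟨z, ⟨hzA, -⟩, hmin⟩ := hK.exists_isMinOn ⟨z₀, hz₀, Metric.mem_closedBall_self hd0.le⟩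
    hc.continuousOn
  have hle : φ z ≤ φ z₀ := hmin ⟨hz₀, Metric.mem_closedBall_self hd0.le⟩
  rw [hφ0] at hle
  have h1 : 0 ≤ d⁻¹ * ‖z - z₀‖ ^ 2 := by positivity
  have h2 : ‖z - z₀‖ ^ 2 ≤ ‖G z₀ - g‖ * d := by
    have h3 : d⁻¹ * ‖z - z₀‖ ^ 2 ≤ ‖G z₀ - g‖ := by
      have := norm_nonneg (G z - g)
      simp only [hφ] at hle
      linarith
    rw [inv_mul_le_iff₀ hd0] at h3
    linarith
  have h3 : ‖z - z₀‖ < d := by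
    have : ‖z - z₀‖ ^ 2 < d ^ 2 := h2.trans_lt (by nlinarith)
    exact lt_of_pow_lt_pow_left₀ 2 hd0.le this
  have hGz : G z ≠ g := hne z hzA h3
  refine ⟨z, hzA, h2, by simp only [hφ] at hle; linarith, hGz, ?_⟩
  have hloc : IsLocalMinOn φ A z := by
    have hb : Metric.ball z₀ d ∈ 𝓝 z := Metric.isOpen_ball.mem_nhds (by simpa [dist_eq_norm])
    filter_upwards [self_mem_nhdsWithin, mem_nhdsWithin_of_mem_nhds hb] with y hyA hy
    exact hmin ⟨hyA, Metric.ball_subset_closedBall hy⟩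
  have hder : HasFDerivAt φ (innerSL ℝ (ContinuousLinearMap.adjoint G (‖G z - g‖⁻¹ • (G z - g)) +
      (2 / d) • (z - z₀))) z := by
    have h4 := (((hasFDerivAt_id z).sub_const z₀).norm_sq).const_mul d⁻¹
    refine ((hasFDerivAt_norm_sub G g (sub_ne_zero.2 hGz)).add h4).congr_fderiv ?_
    ext w
    simp [div_eq_inv_mul, mul_assoc]
  refine ⟨_, neg_mem_regularNormalCone_of_isLocalMinOn hzA hloc hder, le_of_eq ?_⟩
  rw [neg_add_rev, add_assoc, neg_add_cancel, add_zero, norm_neg, norm_smul,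
    Real.norm_of_nonneg (by positivity)]

/-- Sequential form of `exists_regularNormal_of_ne`, with control of the direction of approach. -/
theorem exists_seq_regularNormal [FiniteDimensional ℝ E] [CompleteSpace E]
    [FiniteDimensional ℝ F] [CompleteSpace F]
    {A : Set E} (hA : IsClosed A) (G : E →L[ℝ] F) {z₀ w : E} {g : ℕ → F} {z : ℕ → E}
    {t d : ℕ → ℝ} (hz : ∀ k, z k ∈ A) (hd : ∀ k, 0 < d k) (hdt : ∀ k, d k ≤ t k)
    (hw : Tendsto (fun k => (t k)⁻¹ • (z k - z₀)) atTop (𝓝 w))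
    (hε : Tendsto (fun k => ‖G (z k) - g k‖ / d k) atTop (𝓝 0))
    (hne : ∀ k, ∀ y ∈ A, ‖y - z k‖ < d k → G y ≠ g k) :
    ∃ (ψ : ℕ → ℕ) (y ξ : ℕ → E) (a : F), StrictMono ψ ∧ ‖a‖ = 1 ∧
      Tendsto (fun k => (t (ψ k))⁻¹ • (y k - z₀)) atTop (𝓝 w) ∧
      (∀ k, ξ k ∈ regularNormalCone A (y k)) ∧
      Tendsto ξ atTop (𝓝 (-ContinuousLinearMap.adjoint G a)) ∧
      (∀ k, G (y k) ≠ g (ψ k)) ∧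
      (∀ k, ‖G (y k) - g (ψ k)‖ ≤ ‖G (z (ψ k)) - g (ψ k)‖) ∧
      Tendsto (fun k => ‖G (y k) - g (ψ k)‖⁻¹ • (G (y k) - g (ψ k))) atTop (𝓝 a) := by
  -- From `N` on the residual is below `d k`, as `exists_regularNormal_of_ne` requires.
  obtain ⟨N, hN⟩ := eventually_atTop.1 (hε.eventually_lt_const one_pos)
  have key : ∀ k, ∃ y ∈ A, ‖y - z (k + N)‖ ^ 2 ≤ ‖G (z (k + N)) - g (k + N)‖ * d (k + N) ∧
      ‖G y - g (k + N)‖ ≤ ‖G (z (k + N)) - g (k + N)‖ ∧ G y ≠ g (k + N) ∧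
      ∃ ξ ∈ regularNormalCone A y,
        ‖ξ + ContinuousLinearMap.adjoint G (‖G y - g (k + N)‖⁻¹ • (G y - g (k + N)))‖ ≤
          2 / d (k + N) * ‖y - z (k + N)‖ := fun k =>
    exists_regularNormal_of_ne hA G (hz _)
      (by have := hN (k + N) (Nat.le_add_left _ _); rwa [div_lt_one (hd _)] at this) (hne _)
  choose y hyA hyd hyle hyne ξ hξ hξd using key
  have hunit : ∀ k, ‖G (y k) - g (k + N)‖⁻¹ • (G (y k) - g (k + N)) ∈ Metric.sphere (0 : F) 1 :=
    fun k => by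
      rw [mem_sphere_zero_iff_norm, norm_smul, norm_inv, norm_norm,
        inv_mul_cancel₀ (norm_ne_zero_iff.2 (sub_ne_zero.2 (hyne k)))]
  obtain ⟨a, ha, χ, hχ, hlim⟩ := (isCompact_sphere (0 : F) 1).tendsto_subseq hunit
  have hshift : Tendsto (fun k => k + N) atTop atTop := tendsto_add_atTop_nat N
  have hψ : StrictMono fun k => χ k + N := fun i j hij => Nat.add_lt_add_right (hχ hij) N
  -- the displacement is small compared with `d`
  have hsmall : Tendsto (fun k => ‖y k - z (k + N)‖ / d (k + N)) atTop (𝓝 0) := by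
    have h1 := (Real.continuous_sqrt.tendsto 0).comp (hε.comp hshift)
    rw [Real.sqrt_zero] at h1
    refine squeeze_zero (fun k => div_nonneg (norm_nonneg _) (hd _).le) (fun k => ?_) h1
    refine Real.le_sqrt_of_sq_le ?_
    change _ ≤ ‖G (z (k + N)) - g (k + N)‖ / d (k + N)
    rw [div_pow, div_le_div_iff₀ (pow_pos (hd _) 2) (hd _), pow_two (d (k + N)), ← mul_assoc]
    exact mul_le_mul_of_nonneg_right (hyd k) (hd _).le
  -- Since `d ≤ t`, moving from `z` to `y` does not change the limiting direction `w`.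
  have hsmall' : Tendsto (fun k => (t (k + N))⁻¹ • (y k - z (k + N))) atTop (𝓝 0) := by
    refine squeeze_zero_norm (fun k => ?_) hsmall
    rw [norm_smul, norm_inv, Real.norm_of_nonneg ((hd _).le.trans (hdt _)), div_eq_inv_mul]
    exact mul_le_mul_of_nonneg_right (inv_anti₀ (hd _) (hdt _)) (norm_nonneg _)
  refine ⟨fun k => χ k + N, fun k => y (χ k), fun k => ξ (χ k), a, hψ, by simpa using ha, ?_,
    fun k => hξ _, ?_, fun k => hyne _, fun k => hyle _, hlim⟩
  · have h1 := (hsmall'.add (hw.comp hshift)).comp hχ.tendsto_atTop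
    rw [zero_add] at h1
    refine h1.congr fun k => ?_
    simp only [Function.comp_apply]
    rw [← smul_add, sub_add_sub_cancel]
  · have h0 : Tendsto (fun k => ξ k + ContinuousLinearMap.adjoint G
        (‖G (y k) - g (k + N)‖⁻¹ • (G (y k) - g (k + N)))) atTop (𝓝 0) := by
      have h1 := hsmall.const_mul 2
      rw [mul_zero] at h1
      refine squeeze_zero_norm (fun k => (hξd k).trans_eq ?_) h1
      ring
    have h1 := (h0.comp hχ.tendsto_atTop).sub
      (((ContinuousLinearMap.adjoint G).continuous.tendsto a).comp hlim)
    rw [zero_sub] at h1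
    refine h1.congr fun k => ?_
    simp only [Function.comp_apply, add_sub_cancel_right]

theorem exists_neg_adjoint_mem_directionalNormalCone [FiniteDimensional ℝ E] [CompleteSpace E]
    [FiniteDimensional ℝ F] [CompleteSpace F]
    {A : Set E} (hA : IsClosed A) (G : E →L[ℝ] F) {z₀ w : E} {g : ℕ → F} {z : ℕ → E}
    {t d : ℕ → ℝ} (ht : Tendsto t atTop (𝓝 0))
    (hz : ∀ k, z k ∈ A) (hd : ∀ k, 0 < d k) (hdt : ∀ k, d k ≤ t k)
    (hw : Tendsto (fun k => (t k)⁻¹ • (z k - z₀)) atTop (𝓝 w))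
    (hε : Tendsto (fun k => ‖G (z k) - g k‖ / d k) atTop (𝓝 0))
    (hne : ∀ k, ∀ y ∈ A, ‖y - z k‖ < d k → G y ≠ g k) :
    ∃ a : F, ‖a‖ = 1 ∧ -ContinuousLinearMap.adjoint G a ∈ directionalNormalCone A z₀ w := by
  obtain ⟨ψ, y, ξ, a, hψ, ha, hyw, hξ, hξa, -, -, -⟩ :=
    exists_seq_regularNormal hA G hz hd hdt hw hε hne
  have htpos : ∀ k, 0 < t k := fun k => (hd k).trans_le (hdt k)
  refine ⟨a, ha, fun k => t (ψ k), _, ξ, fun k => htpos _, ht.comp hψ.tendsto_atTop, hyw, hξa,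
    fun k => ?_⟩
  rw [smul_inv_smul₀ (htpos _).ne', add_sub_cancel]
  exact hξ k

/-- A sequence of points other than their limit has a subsequence with convergent directions. -/
theorem exists_subseq_tendsto_unit_direction [FiniteDimensional ℝ E] {z₀ : E} {z : ℕ → E}
    (hz : ∀ k, z k ≠ z₀) : ∃ (ψ : ℕ → ℕ) (w : E), StrictMono ψ ∧ ‖w‖ = 1 ∧
      Tendsto (fun k => ‖z (ψ k) - z₀‖⁻¹ • (z (ψ k) - z₀)) atTop (𝓝 w) := by
  have hunit : ∀ k, ‖z k - z₀‖⁻¹ • (z k - z₀) ∈ Metric.sphere (0 : E) 1 := fun k => by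
    rw [mem_sphere_zero_iff_norm, norm_smul, norm_inv, norm_norm,
      inv_mul_cancel₀ (norm_ne_zero_iff.2 (sub_ne_zero.2 (hz k)))]
  obtain ⟨w, hw, ψ, hψ, hlim⟩ := (isCompact_sphere (0 : E) 1).tendsto_subseq hunit
  exact ⟨ψ, w, hψ, by simpa using hw, hlim⟩

theorem mem_tangentCone_of_mem_directionalNormalCone {A : Set E} {z₀ w ξ : E}
    (h : ξ ∈ directionalNormalCone A z₀ w) : w ∈ tangentCone A z₀ := by
  obtain ⟨t, y, η, ht, ht0, hy, -, hη⟩ := h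
  exact ⟨t, y, ht, ht0, hy, fun k => (hη k).1⟩

/-- First order sufficient condition for metric subregularity of a linear map restricted to a
closed set. -/
theorem exists_infDist_le_of_directionalNormalCone [FiniteDimensional ℝ E] [CompleteSpace E]
    [FiniteDimensional ℝ F] [CompleteSpace F]
    {A : Set E} (hA : IsClosed A) (G : E →L[ℝ] F) {z₀ : E} (hz₀ : z₀ ∈ A)
    (h : ∀ (w : E) (a : F), ‖w‖ = 1 → ‖a‖ = 1 → G w = 0 →
      -ContinuousLinearMap.adjoint G a ∉ directionalNormalCone A z₀ w) :
    ∃ κ : ℝ, 0 ≤ κ ∧ ∃ ε > 0, ∀ z ∈ A, ‖z - z₀‖ < ε →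
      Metric.infDist z {y ∈ A | G y = G z₀} ≤ κ * ‖G z - G z₀‖ := by
  by_contra! hcon
  have hcon' : ∀ k : ℕ, ∃ z ∈ A, ‖z - z₀‖ < 1 / ((k : ℝ) + 1) ∧
      ((k : ℝ) + 1) * ‖G z - G z₀‖ < Metric.infDist z {y ∈ A | G y = G z₀} := fun k =>
    hcon (k + 1) (by positivity) (1 / ((k : ℝ) + 1)) (by positivity)
  choose z hzA hz0 hzd using hcon'
  set C : Set E := {y ∈ A | G y = G z₀} with hC
  have hd : ∀ k, 0 < Metric.infDist (z k) C := fun k => lt_of_le_of_lt (by positivity) (hzd k)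
  have hdt : ∀ k, Metric.infDist (z k) C ≤ ‖z k - z₀‖ := fun k => by
    rw [← dist_eq_norm]
    exact Metric.infDist_le_dist_of_mem ⟨hz₀, rfl⟩
  obtain ⟨ψ, w, hψ, hw, hlim⟩ := exists_subseq_tendsto_unit_direction (z₀ := z₀) (z := z)
    fun k hk => by
      have := (hd k).trans_le (hdt k)
      simp [hk] at this
  have ht : Tendsto (fun k => ‖z k - z₀‖) atTop (𝓝 0) :=
    squeeze_zero (fun k => norm_nonneg _) (fun k => (hz0 k).le)
      tendsto_one_div_add_atTop_nhds_zero_nat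
  have hε : Tendsto (fun k => ‖G (z k) - G z₀‖ / Metric.infDist (z k) C) atTop (𝓝 0) := by
    refine squeeze_zero (fun k => div_nonneg (norm_nonneg _) (hd k).le) (fun k => ?_)
      tendsto_one_div_add_atTop_nhds_zero_nat
    rw [div_le_div_iff₀ (hd k) (by positivity)]
    linarith [hzd k]
  -- The residual is `o(d)` and `d ≤ t`, so the difference quotients of `G` vanish in the limit.
  have hGw : G w = 0 := by
    refine tendsto_nhds_unique ((G.continuous.tendsto w).comp hlim) ?_
    refine squeeze_zero_norm (fun k => ?_) (hε.comp hψ.tendsto_atTop)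
    simp only [Function.comp_apply, map_smul, map_sub, norm_smul, norm_inv, norm_norm]
    rw [div_eq_inv_mul]
    exact mul_le_mul_of_nonneg_right (inv_anti₀ (hd _) (hdt _)) (norm_nonneg _)
  -- With `d` the distance to the solution set `C`, the open ball of radius `d` contains no
  -- solution.
  obtain ⟨a, ha, hmem⟩ := exists_neg_adjoint_mem_directionalNormalCone hA G (z₀ := z₀) (w := w)
    (g := fun _ => G z₀) (z := fun k => z (ψ k)) (t := fun k => ‖z (ψ k) - z₀‖)
    (d := fun k => Metric.infDist (z (ψ k)) C) (ht.comp hψ.tendsto_atTop) (fun k => hzA _)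
    (fun k => hd _) (fun k => hdt _) hlim (hε.comp hψ.tendsto_atTop)
    (fun k y hy hyd hGy => by
      have := Metric.infDist_le_dist_of_mem (x := z (ψ k)) (show y ∈ C from ⟨hy, hGy⟩)
      rw [dist_comm, dist_eq_norm] at this
      linarith)
  exact h w a hw ha hGw hmem

/-- A derivable tangent `w` in the kernel of `G` along which no directional normal lies in the range
of the adjoint of `G` makes `G`, restricted to the closed set `A`, open with linear rate. -/
theorem exists_linear_bound_preimage_of_isDerivableTangent [FiniteDimensional ℝ E]
    [CompleteSpace E] [FiniteDimensional ℝ F] [CompleteSpace F]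
    {A : Set E} (hA : IsClosed A) (G : E →L[ℝ] F) {z₀ w : E} (hz₀ : z₀ ∈ A)
    (hw : IsDerivableTangent A z₀ w) (hGw : G w = 0)
    (h : ∀ a : F, ‖a‖ = 1 → -ContinuousLinearMap.adjoint G a ∉ directionalNormalCone A z₀ w) :
    ∃ L : ℝ, ∀ᶠ g in 𝓝 (G z₀), ∃ z ∈ A, G z = g ∧ ‖z - z₀‖ ≤ L * ‖g - G z₀‖ := by
  obtain ⟨-, ε, hε, ζ, hζA, -, hζ⟩ := hw
  by_contra! hcon
  -- The square leaves a factor `1 / (k + 1)` after multiplication by `k + 1`, which forces `t k →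
  -- 0` below.
  have hcon' : ∀ k : ℕ, ∃ g, ‖g - G z₀‖ < (1 / ((k : ℝ) + 1)) ^ 2 ∧
      ∀ z ∈ A, G z = g → ((k : ℝ) + 1) * ‖g - G z₀‖ < ‖z - z₀‖ := fun k => by
    have hb := Metric.ball_mem_nhds (G z₀) (show 0 < (1 / ((k : ℝ) + 1)) ^ 2 by positivity)
    obtain ⟨g, hg, hgb⟩ := ((hcon (k + 1)).and_eventually hb).exists
    exact ⟨g, (dist_eq_norm g (G z₀)).symm.trans_lt hgb, hg⟩
  choose g hg hfar using hcon'
  -- Eventually `‖ζ (t k) - z₀‖ ≤ t k * (‖w‖ + 1)`, so the ball of radius `t k` about `ζ (t k)`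
  -- stays within `c * t k = (k + 1) * ‖g k - G z₀‖` of `z₀`, where `g k` has no preimage in `A`.
  set c : ℝ := ‖w‖ + 2 with hc
  have hcpos : 0 < c := by positivity
  set t : ℕ → ℝ := fun k => ((k : ℝ) + 1) * ‖g k - G z₀‖ / c with ht
  have hgpos : ∀ k, 0 < ‖g k - G z₀‖ := fun k => by
    refine norm_pos_iff.2 (sub_ne_zero.2 fun h0 => ?_)
    have := hfar k z₀ hz₀ h0.symm
    simp [h0] at this
  have htpos : ∀ k, 0 < t k := fun k => div_pos (mul_pos (by positivity) (hgpos k)) hcpos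
  have ht0 : Tendsto t atTop (𝓝 0) := by
    refine squeeze_zero (fun k => (htpos k).le) (fun k => ?_)
      tendsto_one_div_add_atTop_nhds_zero_nat
    refine (div_le_self (mul_pos (by positivity) (hgpos k)).le
      (by linarith [norm_nonneg w])).trans ?_
    have h1 := mul_le_mul_of_nonneg_left (hg k).le (show (0 : ℝ) ≤ (k : ℝ) + 1 by positivity)
    refine h1.trans_eq ?_
    field_simp
  have ht0' : Tendsto t atTop (𝓝[>] 0) :=
    tendsto_nhdsWithin_iff.2 ⟨ht0, Eventually.of_forall htpos⟩
  set e : ℕ → E := fun k => (t k)⁻¹ • (ζ (t k) - (z₀ + t k • w)) with he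
  have he0 : Tendsto e atTop (𝓝 0) := by
    have h1 := (hζ.comp_tendsto ht0').norm_norm.tendsto_div_nhds_zero
    refine tendsto_zero_iff_norm_tendsto_zero.2 (h1.congr fun k => ?_)
    simp only [he, Function.comp_apply, norm_smul, norm_inv, div_eq_inv_mul]
  have hew : ∀ k, (t k)⁻¹ • (ζ (t k) - z₀) = e k + w := fun k => by
    simp only [he]
    rw [← sub_sub, smul_sub _ (ζ (t k) - z₀), inv_smul_smul₀ (htpos k).ne', sub_add_cancel]
  have hζe : ∀ k, ζ (t k) - z₀ = t k • (e k + w) := fun k => by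
    rw [← hew, smul_inv_smul₀ (htpos k).ne']
  obtain ⟨N, hN⟩ := eventually_atTop.1
    ((ht0.eventually_lt_const hε).and (he0.norm.eventually_lt_const (by simp : ‖(0 : E)‖ < 1)))
  have hshift : Tendsto (fun k => k + N) atTop atTop := tendsto_add_atTop_nat N
  obtain ⟨a, ha, hmem⟩ := exists_neg_adjoint_mem_directionalNormalCone hA G (z₀ := z₀) (w := w)
    (g := fun k => g (k + N)) (z := fun k => ζ (t (k + N))) (t := fun k => t (k + N))
    (d := fun k => t (k + N)) (ht0.comp hshift)
    (fun k => hζA _ ⟨(htpos _).le, (hN (k + N) (Nat.le_add_left _ _)).1.le⟩)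
    (fun k => htpos _) (fun k => le_rfl)
    (by
      have h1 := (he0.comp hshift).add_const w
      rw [zero_add] at h1
      exact h1.congr fun k => (hew (k + N)).symm)
    -- As `G w = 0`, the residual divided by `t` comes only from the curve's error `e` and from `‖g
    -- - G z₀‖ / t = c / (k + 1)`.
    (by
      have h1 : Tendsto (fun k => ‖G (e k)‖ + c * (1 / ((k : ℝ) + 1))) atTop (𝓝 0) := by
        have h2 := ((G.continuous.tendsto 0).comp he0).norm.add
          ((tendsto_one_div_add_atTop_nhds_zero_nat (𝕜 := ℝ)).const_mul c)
        rwa [map_zero, norm_zero, mul_zero, add_zero] at h2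
      refine squeeze_zero (fun k => by have := htpos (k + N); positivity) (fun k => ?_)
        (h1.comp hshift)
      change ‖G (ζ (t (k + N))) - g (k + N)‖ / t (k + N) ≤
        ‖G (e (k + N))‖ + c * (1 / (((k + N : ℕ) : ℝ) + 1))
      generalize k + N = j
      have h2 : G (ζ (t j)) - g j = t j • G (e j) - (g j - G z₀) := by
        have h3 := congrArg G (hζe j)
        rw [map_sub, map_smul, map_add, hGw, add_zero] at h3
        rw [← h3]
        abel
      have h4 : ‖g j - G z₀‖ = t j * (c * (1 / ((j : ℝ) + 1))) := by
        simp only [ht]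
        field_simp
      rw [div_le_iff₀ (htpos j), h2]
      refine (norm_sub_le _ _).trans_eq ?_
      rw [norm_smul, Real.norm_of_nonneg (htpos j).le, h4]
      ring)
    (fun k y hy hyd hGy => by
      have h1 := hfar _ y hy hGy
      have h2 : ((k + N : ℕ) + 1 : ℝ) * ‖g (k + N) - G z₀‖ = t (k + N) * c :=
        (div_mul_cancel₀ _ hcpos.ne').symm
      have h3 : ‖ζ (t (k + N)) - z₀‖ ≤ t (k + N) * (1 + ‖w‖) := by
        rw [hζe, norm_smul, Real.norm_of_nonneg (htpos _).le]
        refine mul_le_mul_of_nonneg_left ((norm_add_le _ _).trans ?_) (htpos _).le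
        linarith [(hN (k + N) (Nat.le_add_left _ _)).2]
      have h4 : ‖y - z₀‖ ≤ ‖y - ζ (t (k + N))‖ + ‖ζ (t (k + N)) - z₀‖ :=
        norm_sub_le_norm_sub_add_norm_sub ..
      rw [h2, hc] at h1
      linarith)
  exact h a ha hmem

end VariationalPrinciple

/-! ### Partial graphs, coordinate projections and their adjoints -/

theorem isClosed_graph_partialMap {P X Y : Type*} [NormedAddCommGroup P] [NormedAddCommGroup X]
    [NormedAddCommGroup Y] {M : WithLp 2 (P × X) → Set Y} (hM : IsClosed (graph M)) (p : P) :
    IsClosed (graph (partialMap M p)) := by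
  have hc : Continuous fun z : WithLp 2 (X × Y) => pair (pair p z.fst) z.snd := by
    refine (WithLp.prod_continuous_toLp 2 _ _).comp (Continuous.prodMk
      ((WithLp.prod_continuous_toLp 2 _ _).comp (continuous_const.prodMk ?_)) ?_)
    · exact WithLp.continuous_fst ..
    · exact WithLp.continuous_snd ..
  exact hM.preimage hc

section ImplicitMultifunctions

variable {P X Y : Type*} [NormedAddCommGroup P] [InnerProductSpace ℝ P]
  [NormedAddCommGroup X] [InnerProductSpace ℝ X] [NormedAddCommGroup Y] [InnerProductSpace ℝ Y]

/-- The projection `((p, x), y) ↦ p`. -/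
noncomputable def paramProj (P X Y : Type*) [NormedAddCommGroup P] [InnerProductSpace ℝ P]
    [NormedAddCommGroup X] [InnerProductSpace ℝ X] [NormedAddCommGroup Y] [InnerProductSpace ℝ Y] :
    WithLp 2 (WithLp 2 (P × X) × Y) →L[ℝ] P :=
  (WithLp.fstL 2 ℝ P X).comp (WithLp.fstL 2 ℝ (WithLp 2 (P × X)) Y)

/-- The projection `((p, x), y) ↦ (p, y)`. -/
noncomputable def paramValueProj (P X Y : Type*) [NormedAddCommGroup P] [InnerProductSpace ℝ P]
    [NormedAddCommGroup X] [InnerProductSpace ℝ X] [NormedAddCommGroup Y] [InnerProductSpace ℝ Y] :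
    WithLp 2 (WithLp 2 (P × X) × Y) →L[ℝ] WithLp 2 (P × Y) :=
  (WithLp.prodContinuousLinearEquiv 2 ℝ P Y).symm.toContinuousLinearMap.comp
    ((paramProj P X Y).prod (WithLp.sndL 2 ℝ (WithLp 2 (P × X)) Y))

@[simp]
theorem paramProj_apply (z : WithLp 2 (WithLp 2 (P × X) × Y)) :
    paramProj P X Y z = z.fst.fst := rfl

@[simp]
theorem paramValueProj_apply (z : WithLp 2 (WithLp 2 (P × X) × Y)) :
    paramValueProj P X Y z = pair z.fst.fst z.snd := rfl

theorem pair_sub_pair {E F : Type*} [AddCommGroup E] [AddCommGroup F] (a b : E) (c d : F) :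
    pair a c - pair b d = pair (a - b) (c - d) := rfl

theorem neg_pair {E F : Type*} [AddCommGroup E] [AddCommGroup F] (a : E) (b : F) :
    -pair a b = pair (-a) (-b) := rfl

theorem norm_pair_le {E F : Type*} [SeminormedAddCommGroup E] [SeminormedAddCommGroup F]
    (a : E) (b : F) : ‖pair a b‖ ≤ ‖a‖ + ‖b‖ := by
  have h : pair a b = pair a 0 + pair 0 b := by
    change pair _ _ = pair (a + 0) (0 + b)
    rw [add_zero, zero_add]
  rw [h]
  refine (norm_add_le _ _).trans_eq ?_
  rw [WithLp.norm_toLp_fst, WithLp.norm_toLp_snd]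

theorem adjoint_sndL [CompleteSpace X] [CompleteSpace Y] (a : Y) :
    ContinuousLinearMap.adjoint (WithLp.sndL 2 ℝ X Y) a = pair 0 a := by
  refine ext_inner_right ℝ fun z => ?_
  rw [ContinuousLinearMap.adjoint_inner_left]
  simp

theorem adjoint_paramProj [CompleteSpace P] [CompleteSpace X] [CompleteSpace Y] (a : P) :
    ContinuousLinearMap.adjoint (paramProj P X Y) a = pair (pair a 0) 0 := by
  refine ext_inner_right ℝ fun z => ?_
  rw [ContinuousLinearMap.adjoint_inner_left]
  simp

theorem adjoint_paramValueProj [CompleteSpace P] [CompleteSpace X] [CompleteSpace Y]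
    (a : WithLp 2 (P × Y)) :
    ContinuousLinearMap.adjoint (paramValueProj P X Y) a = pair (pair a.fst 0) a.snd := by
  refine ext_inner_right ℝ fun z => ?_
  rw [ContinuousLinearMap.adjoint_inner_left]
  simp

/-- Transfers error bounds from the graph to the `x`-space. Nonemptiness of `C` matters because
`Metric.infDist` to the empty set is `0`. -/
theorem infDist_le_infDist_of_mapsTo {α β : Type*} [PseudoMetricSpace α] [PseudoMetricSpace β]
    {f : α → β} (hf : ∀ x y, dist (f x) (f y) ≤ dist x y) {C : Set α} {S : Set β}
    (hCS : Set.MapsTo f C S) (hC : C.Nonempty) (x : α) :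
    Metric.infDist (f x) S ≤ Metric.infDist x C :=
  (Metric.le_infDist hC).2 fun _ hy => (Metric.infDist_le_dist_of_mem (hCS hy)).trans (hf _ _)

end ImplicitMultifunctions

/-! ### Calmness and solvability of the implicit multifunction -/

section Calmness

/-- Directional condition for metric subregularity of `M_{p₀}` at `(x₀, 0)`. -/
theorem partialMap_metricSubregular {P X Y : Type*} [NormedAddCommGroup P]
    [NormedAddCommGroup X] [InnerProductSpace ℝ X] [FiniteDimensional ℝ X] [CompleteSpace X]
    [NormedAddCommGroup Y] [InnerProductSpace ℝ Y] [FiniteDimensional ℝ Y] [CompleteSpace Y]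
    {M : WithLp 2 (P × X) → Set Y} (hM : IsClosed (graph M)) {p₀ : P} {x₀ : X}
    (hx₀ : x₀ ∈ solutionMap M p₀)
    (h : ¬ ∃ (u : X) (v : Y), u ≠ 0 ∧ ‖v‖ = 1 ∧
      0 ∈ graphicalDerivative (partialMap M p₀) x₀ 0 u ∧
      0 ∈ directionalCoderivative (partialMap M p₀) x₀ 0 u 0 v) :
    ∃ κ : ℝ, 0 ≤ κ ∧ ∃ ε > 0, ∀ x y, y ∈ M (pair p₀ x) → ‖pair x y - pair x₀ 0‖ < ε →
      Metric.infDist x (solutionMap M p₀) ≤ κ * ‖y‖ := by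
  have hmem : pair x₀ (0 : Y) ∈ graph (partialMap M p₀) := hx₀
  obtain ⟨κ, hκ, ε, hε, hd⟩ := exists_infDist_le_of_directionalNormalCone
    (isClosed_graph_partialMap hM p₀) (WithLp.sndL 2 ℝ X Y) hmem (by
      rintro ⟨w₁, w₂⟩ a hw ha hGw hN
      obtain rfl : w₂ = 0 := hGw
      rw [adjoint_sndL] at hN
      refine h ⟨w₁, a, ?_, ha, mem_tangentCone_of_mem_directionalNormalCone hN, ?_⟩
      · rintro rfl
        exact zero_ne_one ((norm_zero (E := WithLp 2 (X × Y))).symm.trans hw)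
      · change pair (0 : X) (-a) ∈
          directionalNormalCone (graph (partialMap M p₀)) (pair x₀ 0) (pair w₁ 0)
        rwa [neg_pair, neg_zero] at hN)
  refine ⟨κ, hκ, ε, hε, fun x y hy hxy => ?_⟩
  have h1 := hd (pair x y) hy hxy
  have hmaps : Set.MapsTo (WithLp.fst : WithLp 2 (X × Y) → X)
      {z ∈ graph (partialMap M p₀) | WithLp.sndL 2 ℝ X Y z = WithLp.sndL 2 ℝ X Y (pair x₀ 0)}
      (solutionMap M p₀) := by
    intro z hz
    have h2 : z.snd = 0 := hz.2
    have h3 : z.snd ∈ M (pair p₀ z.fst) := hz.1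
    rwa [h2] at h3
  refine (infDist_le_infDist_of_mapsTo WithLp.dist_fst_le hmaps ⟨_, hmem, rfl⟩
    (pair x y)).trans (h1.trans_eq ?_)
  change κ * ‖y - 0‖ = _
  rw [sub_zero]

variable {P X Y : Type*} [NormedAddCommGroup P] [InnerProductSpace ℝ P] [CompleteSpace P]
  [NormedAddCommGroup X] [InnerProductSpace ℝ X] [CompleteSpace X]
  [NormedAddCommGroup Y] [InnerProductSpace ℝ Y] [CompleteSpace Y]

/-- The kernel of `(p, x, y) ↦ (p, y)` consists of the directions `(0, u, 0)`, and its adjoint sends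
`(a₁, a₂)` to `(a₁, 0, a₂)`. An offending normal thus gives `q* = -a₁`, `v* = a₂`, the coderivative
carrying its own minus sign on `v*`. -/
theorem neg_adjoint_paramValueProj_notMem {M : WithLp 2 (P × X) → Set Y} {p₀ : P} {x₀ : X}
    (h : ¬ ∃ (u : X) (qs : P) (vs : Y), u ≠ 0 ∧ (qs, vs) ≠ (0, 0) ∧
      0 ∈ graphicalDerivative M (pair p₀ x₀) 0 (pair 0 u) ∧
      pair qs 0 ∈ directionalCoderivative M (pair p₀ x₀) 0 (pair 0 u) 0 vs)
    {w : WithLp 2 (WithLp 2 (P × X) × Y)} {a : WithLp 2 (P × Y)} (hw : w ≠ 0) (ha : ‖a‖ = 1)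
    (hGw : paramValueProj P X Y w = 0) :
    -ContinuousLinearMap.adjoint (paramValueProj P X Y) a ∉
      directionalNormalCone (graph M) (pair (pair p₀ x₀) 0) w := by
  intro hN
  obtain ⟨⟨w₁, w₂⟩, w₃⟩ := w
  obtain ⟨a₁, a₂⟩ := a
  obtain rfl : w₁ = 0 := congrArg WithLp.fst hGw
  obtain rfl : w₃ = 0 := congrArg WithLp.snd hGw
  rw [adjoint_paramValueProj] at hN
  refine h ⟨w₂, -a₁, a₂, ?_, ?_, mem_tangentCone_of_mem_directionalNormalCone hN, ?_⟩
  · rintro rfl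
    exact hw rfl
  · intro h0
    obtain ⟨h1, rfl⟩ := Prod.mk.inj h0
    obtain rfl := neg_eq_zero.1 h1
    exact zero_ne_one ((norm_zero (E := WithLp 2 (P × Y))).symm.trans ha)
  · change pair (pair (-a₁) (0 : X)) (-a₂) ∈
      directionalNormalCone (graph M) (pair (pair p₀ x₀) 0) (pair (pair 0 w₂) 0)
    rwa [neg_pair, neg_pair, neg_zero] at hN

variable [FiniteDimensional ℝ P] [FiniteDimensional ℝ X] [FiniteDimensional ℝ Y]

/-- At a graph point `(p, x, 0)` the residual of `(p, x, y) ↦ (p, y)` is exactly `‖p - p₀‖`, and its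
fiber over `(p₀, 0)` is a copy of `S(p₀)`. -/
theorem isCalmAt_solutionMap_of_directionalCoderivative {M : WithLp 2 (P × X) → Set Y}
    (hM : IsClosed (graph M)) {p₀ : P} {x₀ : X} (hx₀ : x₀ ∈ solutionMap M p₀)
    (h : ¬ ∃ (u : X) (qs : P) (vs : Y), u ≠ 0 ∧ (qs, vs) ≠ (0, 0) ∧
      0 ∈ graphicalDerivative M (pair p₀ x₀) 0 (pair 0 u) ∧
      pair qs 0 ∈ directionalCoderivative M (pair p₀ x₀) 0 (pair 0 u) 0 vs) :
    IsCalmAt (solutionMap M) p₀ x₀ := by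
  have hmem : pair (pair p₀ x₀) (0 : Y) ∈ graph M := hx₀
  obtain ⟨κ, hκ, ε, hε, hd⟩ := exists_infDist_le_of_directionalNormalCone hM
    (paramValueProj P X Y) hmem fun w a hw ha hGw =>
      neg_adjoint_paramValueProj_notMem h (norm_ne_zero_iff.1 (hw ▸ one_ne_zero)) ha hGw
  have hf : ∀ z z' : WithLp 2 (WithLp 2 (P × X) × Y), dist z.fst.snd z'.fst.snd ≤ dist z z' :=
    fun z z' => (WithLp.dist_snd_le _ _).trans (WithLp.dist_fst_le _ _)
  refine ⟨hx₀, κ, hκ, ε / 2, half_pos hε, fun p x hp hx hS => ?_⟩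
  have hnorm : ‖pair (pair p x) (0 : Y) - pair (pair p₀ x₀) 0‖ < ε := by
    rw [pair_sub_pair, sub_zero, WithLp.norm_toLp_fst, pair_sub_pair]
    calc _ ≤ ‖p - p₀‖ + ‖x - x₀‖ := norm_pair_le _ _
      _ < ε := by rw [← dist_eq_norm, ← dist_eq_norm]; linarith
  have h1 := hd (pair (pair p x) 0) hS hnorm
  have hmaps : Set.MapsTo (fun z : WithLp 2 (WithLp 2 (P × X) × Y) => z.fst.snd)
      {z ∈ graph M | paramValueProj P X Y z = paramValueProj P X Y (pair (pair p₀ x₀) 0)}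
      (solutionMap M p₀) := by
    intro z hz
    have h2 : z.fst.fst = p₀ := congrArg WithLp.fst hz.2
    have h3 : z.snd = 0 := congrArg WithLp.snd hz.2
    have h4 : z.snd ∈ M (pair z.fst.fst z.fst.snd) := hz.1
    rwa [h2, h3] at h4
  refine (infDist_le_infDist_of_mapsTo hf hmaps ⟨_, hmem, rfl⟩
    (pair (pair p x) (0 : Y))).trans (h1.trans_eq ?_)
  change κ * ‖pair (p - p₀) ((0 : Y) - 0)‖ = _
  rw [sub_self, WithLp.norm_toLp_fst, dist_eq_norm]

theorem isCalmAt_solutionMap_of_outerCoderivative {M : WithLp 2 (P × X) → Set Y}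
    (hM : IsClosed (graph M)) {p₀ : P} {x₀ : X} (hx₀ : x₀ ∈ solutionMap M p₀)
    (h : ¬ ∃ (u : X) (q qs : P), u ≠ 0 ∧ q ∈ tangentCone (domain (paramGraph M)) p₀ ∧ ‖qs‖ = 1 ∧
      0 ∈ graphicalDerivative M (pair p₀ x₀) 0 (pair 0 u) ∧
      pair qs 0 ∈ outerCoderivative M p₀ x₀ u 0 ∧ inner ℝ qs q = -1)
    (h' : ¬ ∃ (u : X) (v : Y), u ≠ 0 ∧ ‖v‖ = 1 ∧
      0 ∈ graphicalDerivative (partialMap M p₀) x₀ 0 u ∧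
      0 ∈ directionalCoderivative (partialMap M p₀) x₀ 0 u 0 v) :
    IsCalmAt (solutionMap M) p₀ x₀ := by
  obtain ⟨κ, hκ, ε, hε, hsub⟩ := partialMap_metricSubregular hM hx₀ h'
  refine ⟨hx₀, ?_⟩
  by_contra! hcon
  have hcon' : ∀ k : ℕ, ∃ p x, dist p p₀ < 1 / ((k : ℝ) + 1) ∧
      dist x x₀ < min (1 / ((k : ℝ) + 1)) (ε / 2) ∧ x ∈ solutionMap M p ∧
      ((k : ℝ) + 1) * dist p p₀ < Metric.infDist x (solutionMap M p₀) := fun k => by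
    -- The bound `ε / 2` keeps the comparison points `(x', y')` used below inside the `ε`-ball where
    -- subregularity holds.
    obtain ⟨p, x, h1, h2, h3, h4⟩ := hcon (k + 1) (by positivity)
      (min (1 / ((k : ℝ) + 1)) (ε / 2)) (lt_min (by positivity) (half_pos hε))
    exact ⟨p, x, h1.trans_le (min_le_left _ _), h2, h3, h4⟩
  choose p x hp hx hS hfar using hcon'
  set z₀ : WithLp 2 (WithLp 2 (P × X) × Y) := pair (pair p₀ x₀) 0 with hz₀
  set z : ℕ → WithLp 2 (WithLp 2 (P × X) × Y) := fun k => pair (pair (p k) (x k)) 0 with hz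
  set D : ℕ → ℝ := fun k => Metric.infDist (x k) (solutionMap M p₀) with hD
  have hDpos : ∀ k, 0 < D k := fun k => lt_of_le_of_lt (by positivity) (hfar k)
  have hDx : ∀ k, D k ≤ dist (x k) x₀ := fun k => Metric.infDist_le_dist_of_mem hx₀
  have hxz : ∀ k, dist (x k) x₀ ≤ ‖z k - z₀‖ := fun k => by
    rw [← dist_eq_norm]
    exact (WithLp.dist_snd_le (z k).fst z₀.fst).trans (WithLp.dist_fst_le (z k) z₀)
  have hne : ∀ k, z k ≠ z₀ := fun k hk => by
    have := (hDpos k).trans_le ((hDx k).trans (hxz k))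
    simp [hk] at this
  have hzp : ∀ k, ‖z k - z₀‖ ≤ dist (p k) p₀ + dist (x k) x₀ := fun k => by
    rw [hz, hz₀, pair_sub_pair, sub_zero, WithLp.norm_toLp_fst, pair_sub_pair, dist_eq_norm,
      dist_eq_norm]
    exact norm_pair_le _ _
  have ht : Tendsto (fun k => ‖z k - z₀‖) atTop (𝓝 0) := by
    have h1 := (tendsto_one_div_add_atTop_nhds_zero_nat (𝕜 := ℝ)).add
      (tendsto_one_div_add_atTop_nhds_zero_nat (𝕜 := ℝ))
    rw [add_zero] at h1
    exact squeeze_zero (fun k => norm_nonneg _) (fun k => (hzp k).trans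
      (add_le_add (hp k).le ((hx k).le.trans (min_le_left _ _)))) h1
  have hpD : Tendsto (fun k => dist (p k) p₀ / D k) atTop (𝓝 0) := by
    refine squeeze_zero (fun k => div_nonneg dist_nonneg (hDpos k).le) (fun k => ?_)
      tendsto_one_div_add_atTop_nhds_zero_nat
    rw [div_le_div_iff₀ (hDpos k) (by positivity)]
    linarith [hfar k]
  have hpt : Tendsto (fun k => dist (p k) p₀ / ‖z k - z₀‖) atTop (𝓝 0) := by
    refine squeeze_zero (fun k => by positivity) (fun k => ?_) hpD
    exact div_le_div_of_nonneg_left dist_nonneg (hDpos k) ((hDx k).trans (hxz k))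
  obtain ⟨χ, w, hχ, hw, hlim⟩ := exists_subseq_tendsto_unit_direction hne
  have hκ1 : 0 < 1 + κ := by linarith
  -- A graph point `(p₀, x', y')` at distance `r` from `z (χ k)` would give `D ≤ κ * ‖y'‖ + dist x
  -- x' ≤ (1 + κ) * r`. Hence `d = D / (1 + κ)` is an admissible radius.
  obtain ⟨ψ, y, ξ, a, hψ, ha, hyw, hξ, hξa, hyne, hyle, hya⟩ :=
    exists_seq_regularNormal hM (paramProj P X Y) (z₀ := z₀) (w := w) (g := fun _ => p₀)
    (z := fun k => z (χ k)) (t := fun k => ‖z (χ k) - z₀‖) (d := fun k => D (χ k) / (1 + κ))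
    (fun k => hS _) (fun k => div_pos (hDpos _) hκ1)
    (fun k => (div_le_self (hDpos _).le (by linarith)).trans ((hDx _).trans (hxz _))) hlim
    (by
      have h1 := (hpD.comp hχ.tendsto_atTop).mul_const (1 + κ)
      rw [zero_mul] at h1
      refine h1.congr fun k => ?_
      simp only [Function.comp_apply, paramProj_apply, hz, dist_eq_norm]
      rw [div_div_eq_mul_div, div_mul_eq_mul_div]
      rfl)
    (by
      rintro k ⟨⟨p', x'⟩, y'⟩ hy hyd hyp
      obtain rfl : p' = p₀ := hyp
      rw [lt_div_iff₀ hκ1] at hyd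
      set r := ‖WithLp.toLp 2 (WithLp.toLp 2 (p', x'), y') - z (χ k)‖ with hr
      have h1 : dist (x (χ k)) x' ≤ r := by
        rw [dist_comm, hr, ← dist_eq_norm]
        exact (WithLp.dist_snd_le (pair p' x') (z (χ k)).fst).trans
          (WithLp.dist_fst_le (pair (pair p' x') y') (z (χ k)))
      have h2 : ‖y'‖ ≤ r := by
        rw [← sub_zero y', hr]
        exact WithLp.norm_snd_le (p := 2) _ (pair (pair p' x') y' - z (χ k))
      have hr0 : 0 ≤ r := norm_nonneg _
      have h3 : ‖pair x' y' - pair x₀ 0‖ < ε := by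
        have h4 : pair x' y' - pair x₀ 0 = pair (x' - x (χ k)) y' + pair (x (χ k) - x₀) 0 := by
          change pair _ _ = pair _ _
          simp
        have h5 : ‖pair (x' - x (χ k)) y'‖ ≤ r := by
          refine le_of_pow_le_pow_left₀ two_ne_zero hr0 ?_
          rw [hr, WithLp.prod_norm_sq_eq_of_L2, WithLp.prod_norm_sq_eq_of_L2]
          have h6 : ‖x' - x (χ k)‖ ≤ ‖pair p' x' - pair (p (χ k)) (x (χ k))‖ :=
            WithLp.norm_snd_le (p := 2) _ (pair p' x' - pair (p (χ k)) (x (χ k)))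
          simp only [hz, WithLp.sub_fst, WithLp.sub_snd, WithLp.toLp_fst, WithLp.toLp_snd, sub_zero]
          gcongr
        have h7 : ‖pair (x (χ k) - x₀) (0 : Y)‖ = dist (x (χ k)) x₀ := by
          rw [WithLp.norm_toLp_fst, dist_eq_norm]
        have h8 : r ≤ r * (1 + κ) := le_mul_of_one_le_right hr0 (by linarith)
        have h9 := (hx (χ k)).trans_le (min_le_right _ _)
        have h10 := hDx (χ k)
        rw [h4]
        refine (norm_add_le _ _).trans_lt ?_
        rw [h7]
        linarith
      have h4 := hsub x' y' hy h3
      have h5 : D (χ k) ≤ Metric.infDist x' (solutionMap M p') + dist (x (χ k)) x' :=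
        Metric.infDist_le_infDist_add_dist
      have h6 := mul_le_mul_of_nonneg_left h2 hκ
      linarith)
  set t : ℕ → ℝ := fun k => ‖z (χ (ψ k)) - z₀‖
  have htpos : ∀ k, 0 < t k := fun k => norm_pos_iff.2 (sub_ne_zero.2 (hne _))
  have hχψ := hχ.tendsto_atTop.comp hψ.tendsto_atTop
  have ht0 : Tendsto t atTop (𝓝 0) := ht.comp hχψ
  have hw1 : w.fst.fst = 0 := by
    refine tendsto_nhds_unique (((paramProj P X Y).continuous.tendsto w).comp hlim) ?_
    refine squeeze_zero_norm (fun k => ?_) (hpt.comp hχ.tendsto_atTop)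
    simp only [Function.comp_apply, map_smul, norm_smul, norm_inv, norm_norm]
    rw [div_eq_inv_mul, dist_eq_norm]
    rfl
  have hw3 : w.snd = 0 := by
    refine tendsto_nhds_unique
      (((WithLp.sndL 2 ℝ (WithLp 2 (P × X)) Y).continuous.tendsto w).comp hlim) ?_
    refine tendsto_const_nhds.congr fun k => ?_
    simp [hz, hz₀]
  obtain ⟨⟨w₁, u⟩, w₃⟩ := w
  obtain rfl : w₁ = 0 := hw1
  obtain rfl : w₃ = 0 := hw3
  have hyt : ∀ k, z₀ + t k • ((t k)⁻¹ • (y k - z₀)) = y k := fun k => by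
    rw [smul_inv_smul₀ (htpos k).ne', add_sub_cancel]
  have hfst := WithLp.continuous_fst (p := 2) (α := WithLp 2 (P × X)) (β := Y)
  have hsnd := WithLp.continuous_snd (p := 2) (α := WithLp 2 (P × X)) (β := Y)
  have hfst' := WithLp.continuous_fst (p := 2) (α := P) (β := X)
  have hsnd' := WithLp.continuous_snd (p := 2) (α := P) (β := X)
  -- The limiting normal is `-(a, 0, 0)`, so `q* = -a`. The tangent is `q = a` itself, whence `⟨q*,
  -- q⟩ = -1`.
  refine h ⟨u, a, -a, ?_, ?_, by rwa [norm_neg], ?_, ?_, ?_⟩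
  · rintro rfl
    exact zero_ne_one ((norm_zero (E := WithLp 2 (WithLp 2 (P × X) × Y))).symm.trans hw)
  -- `a` is the limit of the normalized parameter displacements of graph points. The tangency scale
  -- is therefore the length of that displacement instead of `t k`.
  · have hpos : ∀ k, 0 < ‖(y k).fst.fst - p₀‖ := fun k => norm_pos_iff.2 (sub_ne_zero.2 (hyne k))
    refine ⟨fun k => ‖(y k).fst.fst - p₀‖, _, hpos, ?_, hya, fun k => ?_⟩
    · refine squeeze_zero (fun k => norm_nonneg _) (fun k => ?_)
        ((tendsto_one_div_add_atTop_nhds_zero_nat (𝕜 := ℝ)).comp hχψ)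
      refine (hyle k).trans ?_
      have := (hp (χ (ψ k))).le
      rwa [dist_eq_norm] at this
    · change p₀ + ‖(y k).fst.fst - p₀‖ • (‖(y k).fst.fst - p₀‖⁻¹ • ((y k).fst.fst - p₀)) ∈ _
      rw [smul_inv_smul₀ (hpos k).ne', add_sub_cancel]
      exact ⟨pair (y k).fst.snd (y k).snd, (hξ k).1⟩
  · exact ⟨t, _, htpos, ht0, hyw, fun k => by rw [hyt]; exact (hξ k).1⟩
  · rw [adjoint_paramProj] at hξa
    refine ⟨t, fun k => ((t k)⁻¹ • (y k - z₀)).fst.fst, fun k => ((t k)⁻¹ • (y k - z₀)).fst.snd,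
      fun k => ((t k)⁻¹ • (y k - z₀)).snd, fun k => (ξ k).fst.fst, fun k => (ξ k).fst.snd,
      fun k => -(ξ k).snd, htpos, ht0, ((hfst'.comp hfst).tendsto _).comp hyw,
      ((hsnd'.comp hfst).tendsto _).comp hyw, (hsnd.tendsto _).comp hyw,
      ((hfst'.comp hfst).tendsto _).comp hξa, ?_, ?_, fun k => ⟨?_, ?_⟩⟩
    · have := ((hsnd'.comp hfst).tendsto _).comp hξa
      simpa [Function.comp_def] using this
    · have := ((hsnd.tendsto _).comp hξa).neg
      simpa [Function.comp_def] using this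
    · exact smul_ne_zero (inv_ne_zero (htpos k).ne') (sub_ne_zero.2 (hyne k))
    · have h1 := hξ k
      rw [← hyt k] at h1
      have h2 : pair (pair (ξ k).fst.fst (ξ k).fst.snd) (- -(ξ k).snd) = ξ k := by
        rw [neg_neg]
        rfl
      have h3 : pair (pair (p₀ + t k • ((t k)⁻¹ • (y k - z₀)).fst.fst)
          (x₀ + t k • ((t k)⁻¹ • (y k - z₀)).fst.snd)) (t k • ((t k)⁻¹ • (y k - z₀)).snd) =
          z₀ + t k • ((t k)⁻¹ • (y k - z₀)) := by
        change _ = pair (pair _ _) (0 + _)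
        rw [zero_add]
        rfl
      rw [h2, h3]
      exact h1
  · rw [inner_neg_left, real_inner_self_eq_norm_sq, ha, one_pow]

/-- Only the values `(p, 0)` near `(p₀, 0)` are needed: a graph point over `(p, 0)` is a solution
for `p`, and its distance to the base point dominates the one between the `x`-components. -/
theorem exists_solution_of_isDerivableTangent {M : WithLp 2 (P × X) → Set Y}
    (hM : IsClosed (graph M)) {p₀ : P} {x₀ : X} (hx₀ : x₀ ∈ solutionMap M p₀)
    (h : ¬ ∃ (u : X) (qs : P) (vs : Y), u ≠ 0 ∧ (qs, vs) ≠ (0, 0) ∧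
      0 ∈ graphicalDerivative M (pair p₀ x₀) 0 (pair 0 u) ∧
      pair qs 0 ∈ directionalCoderivative M (pair p₀ x₀) 0 (pair 0 u) 0 vs)
    {u : X} (hu : u ≠ 0)
    (hder : IsDerivableTangent (graph M) (pair (pair p₀ x₀) 0) (pair (pair 0 u) 0)) :
    ∃ L : ℝ, ∃ W ∈ 𝓝 p₀, ∀ p ∈ W, (solutionMap M p).Nonempty ∧
      Metric.infDist x₀ (solutionMap M p) ≤ L * dist p p₀ := by
  have hmem : pair (pair p₀ x₀) (0 : Y) ∈ graph M := hx₀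
  have hw : (pair (pair 0 u) 0 : WithLp 2 (WithLp 2 (P × X) × Y)) ≠ 0 := fun h0 =>
    hu (congrArg (fun z => z.fst.snd) h0)
  obtain ⟨L, hL⟩ := exists_linear_bound_preimage_of_isDerivableTangent hM (paramValueProj P X Y)
    hmem hder rfl fun a ha => neg_adjoint_paramValueProj_notMem h hw ha rfl
  have hc : Tendsto (fun p : P => pair p (0 : Y)) (𝓝 p₀)
      (𝓝 (paramValueProj P X Y (pair (pair p₀ x₀) 0))) :=
    ((WithLp.prod_continuous_toLp 2 P Y).comp
      (continuous_id.prodMk continuous_const)).tendsto p₀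
  refine ⟨L, _, hc.eventually hL, fun p hp => ?_⟩
  obtain ⟨⟨⟨p', x⟩, y⟩, hz, hG, hle⟩ := hp
  obtain rfl : p' = p := congrArg WithLp.fst hG
  obtain rfl : y = 0 := congrArg WithLp.snd hG
  refine ⟨⟨x, hz⟩, (Metric.infDist_le_dist_of_mem (show x ∈ solutionMap M p' from hz)).trans ?_⟩
  have h1 : dist x₀ x ≤ ‖pair (pair p' x) (0 : Y) - pair (pair p₀ x₀) 0‖ := by
    rw [dist_comm, ← dist_eq_norm]
    exact (WithLp.dist_snd_le (pair p' x) (pair p₀ x₀)).trans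
      (WithLp.dist_fst_le (pair (pair p' x) (0 : Y)) (pair (pair p₀ x₀) 0))
  refine h1.trans (hle.trans_eq ?_)
  change L * ‖pair (p' - p₀) ((0 : Y) - 0)‖ = _
  rw [sub_self, WithLp.norm_toLp_fst, dist_eq_norm]

end Calmness

end ImplicitMultifunction

open ImplicitMultifunction
theorem mainTheorem12 (l n m : ℕ)
    (M : WithLp 2 (EuclideanSpace ℝ (Fin l) × EuclideanSpace ℝ (Fin n)) →
      Set (EuclideanSpace ℝ (Fin m)))
    (hM : IsClosed (graph M))
    (p₀ : EuclideanSpace ℝ (Fin l)) (x₀ : EuclideanSpace ℝ (Fin n))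
    (hx₀ : x₀ ∈ solutionMap M p₀) :
    -- part (i)
    (((¬ ∃ (u : EuclideanSpace ℝ (Fin n)) (q qStar : EuclideanSpace ℝ (Fin l)),
          u ≠ 0 ∧ q ∈ tangentCone (domain (paramGraph M)) p₀ ∧ ‖qStar‖ = 1 ∧
          0 ∈ graphicalDerivative M (pair p₀ x₀) 0 (pair 0 u) ∧
          pair qStar 0 ∈ outerCoderivative M p₀ x₀ u 0 ∧
          inner ℝ qStar q = -1) ∧
        (¬ ∃ (u' : EuclideanSpace ℝ (Fin n)) (vStar : EuclideanSpace ℝ (Fin m)),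
          u' ≠ 0 ∧ ‖vStar‖ = 1 ∧
          0 ∈ graphicalDerivative (partialMap M p₀) x₀ 0 u' ∧
          0 ∈ directionalCoderivative (partialMap M p₀) x₀ 0 u' 0 vStar)) →
      IsCalmAt (solutionMap M) p₀ x₀) ∧
    -- part (ii)
    (((¬ ∃ (u : EuclideanSpace ℝ (Fin n)) (qStar : EuclideanSpace ℝ (Fin l))
          (vStar : EuclideanSpace ℝ (Fin m)),
          u ≠ 0 ∧ (qStar, vStar) ≠ (0, 0) ∧
          0 ∈ graphicalDerivative M (pair p₀ x₀) 0 (pair 0 u) ∧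
          pair qStar 0 ∈ directionalCoderivative M (pair p₀ x₀) 0 (pair 0 u) 0 vStar) ∧
        (∃ u' : EuclideanSpace ℝ (Fin n), u' ≠ 0 ∧
          IsDerivableTangent (graph M) (pair (pair p₀ x₀) 0) (pair (pair 0 u') 0))) →
      IsCalmAt (solutionMap M) p₀ x₀ ∧
      ∃ L : ℝ, ∃ W ∈ 𝓝 p₀, ∀ p ∈ W, (solutionMap M p).Nonempty ∧
        Metric.infDist x₀ (solutionMap M p) ≤ L * dist p p₀) := by
  refine ⟨fun h => isCalmAt_solutionMap_of_outerCoderivative hM hx₀ h.1 h.2, ?_⟩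
  rintro ⟨h, u, hu, hder⟩
  exact ⟨isCalmAt_solutionMap_of_directionalCoderivative hM hx₀ h,
    exists_solution_of_isDerivableTangent hM hx₀ h hu hder⟩
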